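/- Let $p\neq q$ be primes, let $n,m\ge 1$, and let $G=\mathrm{El}(p^n)\times\mathrm{El}(q^m)$, where $\mathrm{El}(r^k)$ denotes the elementary abelian group of order $r^k$. The power graph $\mathcal P(G)$ is the simple graph with vertex set $G$ in which two distinct elements $a,b$ are adjacent if and only if $b^k=a$ or $a^k=b$ for some positive integer $k$. Let $A$ be its adjacency matrix, let $\phi(M,x)=\det(xI-M)$ denote the characteristic polynomial of a matrix $M$, and put $\alpha=\frac{p^n-1}{p-1}$, $\beta=\frac{q^m-1}{q-1}$. Write $e$ for the identity element of either factor, and let $$V_1=\{(e,e)\},\quad V_2=\{(a,e):a\ne e\},\quad V_3=\{(a,b):a\neq e,\ b\neq e\},\quad V_4=\{(e,b):b\neq e\}.$$ Then $\{V_1,V_2,V_3,V_4\}$ is an equitable partition of $\mathcal P(G)$ (the number of neighbours in $V_j$ of a vertex of $V_i$ depends only on $i$ and $j$), its quotient matrix $T_1$ (whose $(i,j)$ entry is this number) is $$T_1=\begin{bmatrix}0&p^n-1&(p^n-1)(q^m-1)&q^m-1\\ 1&p-2&(p-1)(q^m-1)&0\\ 1&p-1&(p-1)(q-1)-1&q-1\\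 1&0&(p^n-1)(q-1)&q-2\end{bmatrix},$$ and the characteristic polynomial of $A$ is $$\phi(A,x)=\phi(T_1,x)\,(x+1)^{p^nq^m-(\alpha+1)(\beta+1)}\,(x-pq+p+q)^{(\alpha-1)(\beta-1)}\,f(x)^{\alpha-1}\,g(x)^{\beta-1},$$ where $f(x)$ and $g(x)$ are the characteristic polynomials of $$\begin{bmatrix}p-2&(p-1)(q^m-1)\\ p-1&(p-1)(q-1)-1\end{bmatrix}\quad\text{and}\quad\begin{bmatrix}(p-1)(q-1)-1&q-1\\ (p^n-1)(q-1)&q-2\end{bmatrix},$$ respectively. -/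

import Mathlib

open Polynomial

/-- The power graph of a group: two distinct elements are adjacent iff one of them is a
(positive) power of the other. -/
def powerGraph (G : Type*) [Group G] : SimpleGraph G where
  Adj a b := a ≠ b ∧ ∃ k : ℕ, 0 < k ∧ (b ^ k = a ∨ a ^ k = b)
  symm := ⟨fun _ _ h => ⟨h.1.symm, h.2.imp fun _ hk => ⟨hk.1, hk.2.symm⟩⟩⟩
  loopless := ⟨fun _ h => h.1 rfl⟩

/-- The commutative group `G` is the elementary abelian group of order `p ^ n` (`p` a prime):
it has `p ^ n` elements, and every element other than the identity has order `p`. -/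
def IsElementaryAbelianOfOrder (G : Type*) [CommGroup G] (p n : ℕ) : Prop :=
  Nat.card G = p ^ n ∧ ∀ g : G, g ≠ 1 → orderOf g = p

/-- The finite sets `X i` form a partition of `V` (nonempty, and every element of `V` is in
exactly one of them) such that each block of `A` cut out by them has constant row sums. -/
def IsEquitablePartition {V ι : Type*} (A : Matrix V V ℝ) (X : ι → Finset V) : Prop :=
  (∀ i, (X i).Nonempty) ∧ (∀ v, ∃! i, v ∈ X i) ∧
    ∀ i j, ∀ u ∈ X i, ∀ v ∈ X i, ∑ w ∈ X j, A u w = ∑ w ∈ X j, A v w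

/-- The quotient matrix of `A` with respect to `X`: its `(i, j)` entry is the average row sum of
the block of `A` with rows in `X i` and columns in `X j`. -/
noncomputable def quotientMatrix {V ι : Type*} (A : Matrix V V ℝ) (X : ι → Finset V) :
    Matrix ι ι ℝ :=
  Matrix.of fun i j => (∑ u ∈ X i, ∑ w ∈ X j, A u w) / ((X i).card : ℝ)

/-- The four cells `{(e, e)}`, `{(a, e) : a ≠ e}`, `{(a, b) : a ≠ e, b ≠ e}`, `{(e, b) : b ≠ e}`
of a product of two groups. -/
def fourCells (P Q : Type*) [Group P] [Group Q] [Fintype P] [Fintype Q]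
    [DecidableEq P] [DecidableEq Q] : Fin 4 → Finset (P × Q) :=
  ![Finset.univ.filter fun x => x.1 = 1 ∧ x.2 = 1,
    Finset.univ.filter fun x => x.1 ≠ 1 ∧ x.2 = 1,
    Finset.univ.filter fun x => x.1 ≠ 1 ∧ x.2 ≠ 1,
    Finset.univ.filter fun x => x.1 = 1 ∧ x.2 ≠ 1]

/-! Call two elements equivalent if they generate the same cyclic subgroup. Since the orders in the
two factors are coprime, a cyclic subgroup of the product is a pair of labels, each trivial or one
of `α` (resp. `β`) subgroups of prime order. Adjacency of distinct elements depends only on labels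
and equivalent elements are adjacent, so `A + 1` is a blow-up of a matrix on `(α+1)(β+1)` labels.
Collapsing it (`charpoly_of_comp_sub_one`) gives the power of `X + 1`.

The collapsed matrix is a star: a centre with trivial first label, joined in the same way to `α`
identical, mutually disconnected blocks. Vectors equal on all copies carry the quotient, and each
further copy contributes the charpoly of one block (`charpoly_fromBlocks_star`). Centre and block
are again stars in the second label, so the reduction is used three times: it leaves `T₁` and `g`
from the centre, `f` and the linear factor from the block. -/

/-! ### Characteristic polynomials of blow-ups and stars -/

namespace Matrix

/-- With `S` the incidence matrix of `c`, the blow-up is `S * (M * Sᵀ)` and `Sᵀ * S` is the diagonal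
of fibre sizes. Swapping the factors costs a power of `X`, which subtracting `1` turns into `X + 1`.
-/
theorem charpoly_of_comp_sub_one {R V ι : Type*} [CommRing R] [Fintype V] [DecidableEq V]
    [Fintype ι] [DecidableEq ι] (c : V → ι) (hc : Function.Surjective c) (M : Matrix ι ι R) :
    ((of fun u v => M (c u) (c v)) - 1 : Matrix V V R).charpoly =
      (X + 1) ^ (Fintype.card V - Fintype.card ι) *
        (M * diagonal (fun i => ((Finset.univ.filter fun v => c v = i).card : R)) - 1).charpoly := by
  set S : Matrix V ι R := of fun v i => if c v = i then 1 else 0 with hS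
  have h1 : (of fun u v => M (c u) (c v) : Matrix V V R) = S * (M * Sᵀ) := by
    ext u v
    simp [hS, mul_apply]
  have h2 : diagonal (fun i => ((Finset.univ.filter fun v => c v = i).card : R)) = Sᵀ * S := by
    ext i j
    by_cases hij : i = j
    · subst hij
      simp only [hS, mul_apply, transpose_apply, of_apply, diagonal_apply_eq]
      simp [← ite_and]
    · simp only [hS, mul_apply, transpose_apply, of_apply, diagonal_apply_ne _ hij]
      refine (Finset.sum_eq_zero fun v _ => ?_).symm
      split_ifs with h h' <;> simp_all
  have h4 (N : Matrix V V R) : (N - 1).charpoly = N.charpoly.comp (X + 1) := by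
    simpa using charpoly_sub_scalar N 1
  have h5 (N : Matrix ι ι R) : (N - 1).charpoly = N.charpoly.comp (X + 1) := by
    simpa using charpoly_sub_scalar N 1
  rw [h4, h5, h1, h2, charpoly_mul_comm_of_le _ _ (Fintype.card_le_of_surjective c hc),
    Matrix.mul_assoc]
  simp

/-- The hypothesis says that the graph of `T` is an invariant subspace; `A + B * T` acts on it and
`D - T * B` on the quotient. A unipotent conjugation makes this triangular. -/
theorem charpoly_fromBlocks_of_intertwine {R m n : Type*} [CommRing R] [Fintype m] [DecidableEq m]
    [Fintype n] [DecidableEq n] (A : Matrix m m R) (B : Matrix m n R) (C : Matrix n m R)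
    (D : Matrix n n R) (T : Matrix n m R) (h : C + D * T = T * (A + B * T)) :
    (fromBlocks A B C D).charpoly = (A + B * T).charpoly * (D - T * B).charpoly := by
  have hE : fromBlocks (1 : Matrix m m R) 0 T (1 : Matrix n n R) * fromBlocks 1 0 (-T) 1 = 1 := by
    simp [fromBlocks_multiply, fromBlocks_one]
  have h1 : fromBlocks (1 : Matrix m m R) 0 (-T) (1 : Matrix n n R) *
      (fromBlocks A B C D * fromBlocks 1 0 T 1) = fromBlocks (A + B * T) B 0 (D - T * B) := by
    simp [fromBlocks_multiply, h, sub_eq_neg_add]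
  rw [← charpoly_fromBlocks_zero₂₁, ← h1, charpoly_mul_comm, Matrix.mul_assoc, hE, Matrix.mul_one]

theorem charpoly_blockDiagonal_const {R n o : Type*} [CommRing R] [Fintype n] [DecidableEq n]
    [Fintype o] [DecidableEq o] (D : Matrix n n R) :
    (blockDiagonal fun _ : o => D).charpoly = D.charpoly ^ Fintype.card o := by
  have : (blockDiagonal fun _ : o => D).charmatrix = blockDiagonal fun _ : o => D.charmatrix := by
    ext ⟨i, k⟩ ⟨j, l⟩
    by_cases hkl : k = l <;> by_cases hij : i = j <;>
      simp [blockDiagonal_apply, hkl, hij]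
  rw [charpoly, this, det_blockDiagonal]
  simp [charpoly]

def _root_.Equiv.sumProdOption (κ₀ κ₁ L : Type*) :
    κ₀ ⊕ (κ₁ × Option L) ≃ (κ₀ ⊕ κ₁) ⊕ (κ₁ × L) where
  toFun
    | .inl i => .inl (.inl i)
    | .inr (i, none) => .inl (.inr i)
    | .inr (i, some l) => .inr (i, l)
  invFun
    | .inl (.inl i) => .inl i
    | .inl (.inr i) => .inr (i, none)
    | .inr (i, l) => .inr (i, some l)
  left_inv := by rintro (i | ⟨i, _ | l⟩) <;> rfl
  right_inv := by rintro ((i | i) | ⟨i, l⟩) <;> rfl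

/-- The copy `none` serves as reference: `T` repeats its coordinates on all other copies, so the
graph of `T` consists of the vectors equal on all copies. -/
theorem charpoly_fromBlocks_star_option {R κ₀ κ₁ L : Type*} [CommRing R]
    [Fintype κ₀] [DecidableEq κ₀] [Fintype κ₁] [DecidableEq κ₁] [Fintype L] [DecidableEq L]
    (A : Matrix κ₀ κ₀ R) (B : Matrix κ₀ κ₁ R) (C : Matrix κ₁ κ₀ R) (D : Matrix κ₁ κ₁ R) :
    (fromBlocks A (of fun i (j : κ₁ × Option L) => B i j.1)
        (of fun (i : κ₁ × Option L) j => C i.1 j) (blockDiagonal fun _ : Option L => D)).charpoly =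
      (fromBlocks A ((Fintype.card (Option L) : R) • B) C D).charpoly *
        D.charpoly ^ Fintype.card L := by
  let P : Matrix (κ₀ ⊕ κ₁) (κ₀ ⊕ κ₁) R := fromBlocks A B C D
  let S : Matrix (κ₀ ⊕ κ₁) (κ₁ × L) R :=
    fromRows (of fun i (j : κ₁ × L) => B i j.1) (0 : Matrix κ₁ (κ₁ × L) R)
  let U : Matrix (κ₁ × L) (κ₀ ⊕ κ₁) R :=
    fromCols (of fun (i : κ₁ × L) j => C i.1 j) (0 : Matrix (κ₁ × L) κ₁ R)
  let T : Matrix (κ₁ × L) (κ₀ ⊕ κ₁) R :=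
    fromCols 0 (of fun (i : κ₁ × L) (j : κ₁) => if i.1 = j then 1 else 0)
  let W : Matrix (κ₁ × L) (κ₁ × L) R := blockDiagonal fun _ : L => D
  have hPS : P + S * T = fromBlocks A ((Fintype.card (Option L) : R) • B) C D := by
    ext (i | i) (j | j) <;>
      simp [P, S, T, mul_apply, Fintype.sum_prod_type, add_mul, add_comm]
  have hTS : T * S = 0 := by
    ext ⟨i, l⟩ ⟨j, l'⟩
    simp [T, S, mul_apply]
  have hU : U + W * T = T * (P + S * T) := by
    rw [hPS]
    ext ⟨i, l⟩ (j | j) <;>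
      simp [U, W, T, mul_apply, Fintype.sum_prod_type, blockDiagonal_apply]
  rw [← charpoly_reindex (Equiv.sumProdOption κ₀ κ₁ L)]
  have : reindex (Equiv.sumProdOption κ₀ κ₁ L) (Equiv.sumProdOption κ₀ κ₁ L)
      (fromBlocks A (of fun i (j : κ₁ × Option L) => B i j.1)
        (of fun (i : κ₁ × Option L) j => C i.1 j) (blockDiagonal fun _ : Option L => D)) =
      fromBlocks P S U W := by
    ext ((i | i) | ⟨i, l⟩) ((j | j) | ⟨j, l'⟩) <;>
      simp [Equiv.sumProdOption, P, S, U, W, blockDiagonal_apply]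
  rw [this, charpoly_fromBlocks_of_intertwine P S U W T hU, hPS, hTS, sub_zero,
    charpoly_blockDiagonal_const]

theorem charpoly_fromBlocks_star {R κ₀ κ₁ L : Type*} [CommRing R]
    [Fintype κ₀] [DecidableEq κ₀] [Fintype κ₁] [DecidableEq κ₁] [Fintype L] [DecidableEq L]
    [Nonempty L]
    (A : Matrix κ₀ κ₀ R) (B : Matrix κ₀ κ₁ R) (C : Matrix κ₁ κ₀ R) (D : Matrix κ₁ κ₁ R) :
    (fromBlocks A (of fun i (j : κ₁ × L) => B i j.1)
        (of fun (i : κ₁ × L) j => C i.1 j) (blockDiagonal fun _ : L => D)).charpoly =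
      (fromBlocks A ((Fintype.card L : R) • B) C D).charpoly * D.charpoly ^ (Fintype.card L - 1) := by
  obtain ⟨k, hk⟩ := Nat.exists_eq_succ_of_ne_zero (Fintype.card_ne_zero (α := L))
  have e : L ≃ Option (Fin k) := Fintype.equivOfCardEq (by simp [hk])
  have h := charpoly_fromBlocks_star_option (L := Fin k) A B C D
  rw [← Fintype.card_congr e, Fintype.card_fin] at h
  rw [show Fintype.card L - 1 = k by omega, ← h,
    ← charpoly_reindex ((Equiv.refl κ₀).sumCongr ((Equiv.refl κ₁).prodCongr e))]
  congr 1
  ext (i | ⟨i, l⟩) (j | ⟨j, l'⟩) <;> simp [blockDiagonal_apply]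

end Matrix

/-! ### Cyclic subgroups and adjacency in the power graph -/

/-- A map `c` to `Option L` labels the elements of the group `G` by the cyclic subgroup that they
generate: `none` is the trivial subgroup, and `some l`, for `l : L`, are the other ones, each of
which has `d` generators. -/
structure IsCyclicLabelling {G L : Type*} [Group G] [Fintype G] [DecidableEq L]
    (c : G → Option L) (d : ℕ) : Prop where
  eq_none_iff : ∀ a, c a = none ↔ a = 1
  card_filter_some : ∀ l, (Finset.univ.filter fun a => c a = some l).card = d
  mem_zpowers_iff : ∀ a b, a ∈ Subgroup.zpowers b ↔ c a = none ∨ c a = c b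

theorem IsElementaryAbelianOfOrder.zpowers_eq_of_mem {G : Type*} [CommGroup G] [Finite G]
    {p n : ℕ} (hG : IsElementaryAbelianOfOrder G p n) {a b : G} (ha : a ≠ 1)
    (hab : a ∈ Subgroup.zpowers b) : Subgroup.zpowers a = Subgroup.zpowers b := by
  have hb : b ≠ 1 := by
    rintro rfl
    simp_all
  refine Subgroup.eq_of_le_of_card_ge (Subgroup.zpowers_le.2 hab) ?_
  rw [Nat.card_zpowers, Nat.card_zpowers, hG.2 a ha, hG.2 b hb]

theorem IsElementaryAbelianOfOrder.exists_isCyclicLabelling {G : Type*} [CommGroup G] [Fintype G]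
    {p n : ℕ} (hG : IsElementaryAbelianOfOrder G p n) :
    ∃ α : ℕ, p ^ n - 1 = α * (p - 1) ∧ ∃ c : G → Option (Fin α), IsCyclicLabelling c (p - 1) := by
  classical
  let L := Set.range fun a : {a : G // a ≠ 1} => Subgroup.zpowers a.1
  have : Fintype L := Fintype.ofFinite L
  let e : L ≃ Fin (Fintype.card L) := Fintype.equivFin L
  let c : G → Option (Fin (Fintype.card L)) := fun a =>
    if h : a = 1 then none else some (e ⟨Subgroup.zpowers a, ⟨a, h⟩, rfl⟩)
  have hnone (a : G) : c a = none ↔ a = 1 := by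
    by_cases h : a = 1 <;> simp [c, h]
  have heq {a b : G} (ha : a ≠ 1) (hb : b ≠ 1) :
      c a = c b ↔ Subgroup.zpowers a = Subgroup.zpowers b := by
    simp only [c, ha, hb, dite_false, Option.some.injEq, e.injective.eq_iff]
    exact Subtype.ext_iff
  have hmem (a b : G) : a ∈ Subgroup.zpowers b ↔ c a = none ∨ c a = c b := by
    rw [hnone]
    by_cases ha : a = 1
    · simp [ha, one_mem]
    by_cases hb : b = 1
    · subst hb
      have : c 1 = none := (hnone 1).2 rfl
      simp [ha, this, hnone]
    · rw [heq ha hb]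
      simp only [ha, false_or]
      exact ⟨hG.zpowers_eq_of_mem ha, fun h => h ▸ Subgroup.mem_zpowers a⟩
  have hcard (l) : (Finset.univ.filter fun a => c a = some l).card = p - 1 := by
    obtain ⟨⟨_, ⟨b, hb⟩, rfl⟩, rfl⟩ := e.surjective l
    have hcb : c b = some (e ⟨Subgroup.zpowers b, ⟨b, hb⟩, rfl⟩) := by simp [c, hb]
    have : (Finset.univ.filter fun a => c a = some (e ⟨Subgroup.zpowers b, ⟨b, hb⟩, rfl⟩)) =
        (Finset.univ.filter fun a => a ∈ Subgroup.zpowers b).erase 1 := by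
      ext a
      simp only [Finset.mem_filter, Finset.mem_univ, true_and, Finset.mem_erase, hmem, ← hcb, ne_eq,
        hnone]
      refine ⟨fun h => ⟨?_, Or.inr h⟩, fun h => h.2.resolve_left h.1⟩
      rwa [← hnone, h, hnone]
    rw [this, Finset.card_erase_of_mem (by simp [one_mem]), ← Fintype.card_subtype,
      ← Nat.card_eq_fintype_card]
    exact congrArg (· - 1) ((Nat.card_zpowers b).trans (hG.2 b hb))
  refine ⟨Fintype.card L, ?_, c, hnone, hcard, hmem⟩
  -- Counting `G` by labels: one identity and `p - 1` generators for each other label.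
  have h0 : (Finset.univ.filter fun a => c a = none).card = 1 :=
    Finset.card_eq_one.2 ⟨1, by ext; simp [hnone]⟩
  have h := Finset.card_eq_sum_card_fiberwise (f := c) (s := Finset.univ) (t := Finset.univ)
    (by simp)
  rw [Fintype.sum_option, h0, Finset.sum_congr rfl fun l _ => hcard l, Finset.card_univ,
    ← Nat.card_eq_fintype_card, hG.1] at h
  simp only [Finset.sum_const, Finset.card_univ, Fintype.card_fin, smul_eq_mul] at h
  omega

/-- The Chinese remainder theorem merges the exponents of the two coordinates into one. -/
theorem mem_zpowers_prod_iff {G H : Type*} [Group G] [Group H] [Finite G] [Finite H]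
    {u v : G × H} (hv : (orderOf v.1).Coprime (orderOf v.2)) :
    u ∈ Subgroup.zpowers v ↔ u.1 ∈ Subgroup.zpowers v.1 ∧ u.2 ∈ Subgroup.zpowers v.2 := by
  simp only [← mem_powers_iff_mem_zpowers, Submonoid.mem_powers_iff]
  constructor
  · rintro ⟨k, rfl⟩
    exact ⟨⟨k, rfl⟩, k, rfl⟩
  · rintro ⟨⟨i, hi⟩, j, hj⟩
    obtain ⟨k, hki, hkj⟩ := Nat.chineseRemainder hv i j
    exact ⟨k, Prod.ext (by rw [← hi, Prod.pow_fst, pow_eq_pow_iff_modEq.2 hki])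
      (by rw [← hj, Prod.pow_snd, pow_eq_pow_iff_modEq.2 hkj])⟩

theorem exists_pos_pow_eq_iff_mem_zpowers {G : Type*} [Group G] [Finite G] {u v : G} :
    (∃ k : ℕ, 0 < k ∧ v ^ k = u) ↔ u ∈ Subgroup.zpowers v := by
  rw [← mem_powers_iff_mem_zpowers, Submonoid.mem_powers_iff]
  -- Adding the order of `v` makes a possibly zero exponent positive.
  refine ⟨fun ⟨k, _, hk⟩ => ⟨k, hk⟩, fun ⟨k, hk⟩ => ⟨k + orderOf v, ?_, ?_⟩⟩
  · exact Nat.add_pos_right _ (orderOf_pos v)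
  · rw [pow_add, pow_orderOf_eq_one, mul_one, hk]

theorem powerGraph_adj_iff {G : Type*} [Group G] [Finite G] {u v : G} :
    (powerGraph G).Adj u v ↔
      u ≠ v ∧ (u ∈ Subgroup.zpowers v ∨ v ∈ Subgroup.zpowers u) := by
  simp only [powerGraph, ← exists_pos_pow_eq_iff_mem_zpowers, and_or_left, exists_or]

theorem IsElementaryAbelianOfOrder.coprime_orderOf {G H : Type*} [CommGroup G] [CommGroup H]
    {p n q m : ℕ} (hG : IsElementaryAbelianOfOrder G p n) (hH : IsElementaryAbelianOfOrder H q m)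
    (hpq : p.Coprime q) (a : G) (b : H) : (orderOf a).Coprime (orderOf b) := by
  by_cases ha : a = 1
  · simp [ha]
  by_cases hb : b = 1
  · simp [hb]
  rwa [hG.2 a ha, hH.2 b hb]

theorem IsElementaryAbelianOfOrder.powerGraph_prod_adj_iff {G H L₁ L₂ : Type*}
    [CommGroup G] [CommGroup H] [Fintype G] [Fintype H] [DecidableEq L₁] [DecidableEq L₂]
    {p n q m d₁ d₂ : ℕ}
    (hG : IsElementaryAbelianOfOrder G p n) (hH : IsElementaryAbelianOfOrder H q m)
    (hpq : p.Coprime q) {c₁ : G → Option L₁} {c₂ : H → Option L₂}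
    (h₁ : IsCyclicLabelling c₁ d₁) (h₂ : IsCyclicLabelling c₂ d₂) (u v : G × H) :
    (powerGraph (G × H)).Adj u v ↔ u ≠ v ∧
      (((c₁ u.1 = none ∨ c₁ u.1 = c₁ v.1) ∧ (c₂ u.2 = none ∨ c₂ u.2 = c₂ v.2)) ∨
        ((c₁ v.1 = none ∨ c₁ v.1 = c₁ u.1) ∧ (c₂ v.2 = none ∨ c₂ v.2 = c₂ u.2))) := by
  rw [powerGraph_adj_iff, mem_zpowers_prod_iff (hG.coprime_orderOf hH hpq _ _),
    mem_zpowers_prod_iff (hG.coprime_orderOf hH hpq _ _)]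
  simp only [h₁.mem_zpowers_iff, h₂.mem_zpowers_iff]

/-! ### The collapsed matrix and its factorization -/

/-- The pattern of the power graph of a product of two groups of coprime orders on the labels of
the cyclic subgroups. -/
def labelMatrix (L₁ L₂ : Type*) [DecidableEq L₁] [DecidableEq L₂] :
    Matrix (Option L₁ × Option L₂) (Option L₁ × Option L₂) ℝ :=
  Matrix.of fun x y =>
    if ((x.1 = none ∨ x.1 = y.1) ∧ (x.2 = none ∨ x.2 = y.2)) ∨
      ((y.1 = none ∨ y.1 = x.1) ∧ (y.2 = none ∨ y.2 = x.2)) then 1 else 0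

/-- The number of elements with a given label. -/
def labelWeight {L : Type*} (d : ℝ) (x : Option L) : ℝ := x.elim 1 fun _ => d

@[simp] theorem labelWeight_none {L : Type*} (d : ℝ) : labelWeight d (none : Option L) = 1 := rfl

@[simp] theorem labelWeight_some {L : Type*} (d : ℝ) (l : L) : labelWeight d (some l) = d := rfl

def Equiv.prodOptionSum (K L : Type*) : Option L × K ≃ K ⊕ (K × L) where
  toFun
    | (none, k) => .inl k
    | (some l, k) => .inr (k, l)
  invFun
    | .inl k => (none, k)
    | .inr (k, l) => (some l, k)
  left_inv := by rintro ⟨_ | l, k⟩ <;> rfl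
  right_inv := by rintro (k | ⟨k, l⟩) <;> rfl

def Equiv.optionSumOption (L : Type*) :
    Option L ⊕ Option L ≃ (Unit ⊕ Unit) ⊕ ((Unit ⊕ Unit) × L) where
  toFun
    | .inl none => .inl (.inl ())
    | .inr none => .inl (.inr ())
    | .inl (some l) => .inr (.inl (), l)
    | .inr (some l) => .inr (.inr (), l)
  invFun
    | .inl (.inl ()) => .inl none
    | .inl (.inr ()) => .inr none
    | .inr (.inl (), l) => .inl (some l)
    | .inr (.inr (), l) => .inr (some l)
  left_inv := by rintro ((_ | l) | (_ | l)) <;> rfl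
  right_inv := by rintro ((_ | _) | ⟨_ | _, l⟩) <;> rfl

def Equiv.optionUnitSum (L : Type*) : Option L ≃ Unit ⊕ (Unit × L) where
  toFun
    | none => .inl ()
    | some l => .inr ((), l)
  invFun
    | .inl () => none
    | .inr ((), l) => some l
  left_inv := by rintro (_ | l) <;> rfl
  right_inv := by rintro (_ | ⟨_, l⟩) <;> rfl

def Equiv.unitSumUnit : Unit ⊕ Unit ≃ Fin 2 where
  toFun := Sum.elim (fun _ => 0) fun _ => 1
  invFun := ![.inl (), .inr ()]
  left_inv := by rintro (_ | _) <;> rfl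
  right_inv := by intro i; fin_cases i <;> rfl

def Equiv.unitSumUnitSum : (Unit ⊕ Unit) ⊕ (Unit ⊕ Unit) ≃ Fin 4 where
  -- The second summand lists `V₄` before `V₃`, hence `3` before `2`.
  toFun := Sum.elim (Sum.elim (fun _ => 0) fun _ => 1) (Sum.elim (fun _ => 3) fun _ => 2)
  invFun := ![.inl (.inl ()), .inl (.inr ()), .inr (.inr ()), .inr (.inl ())]
  left_inv := by rintro ((_ | _) | (_ | _)) <;> rfl
  right_inv := by intro i; fin_cases i <;> rfl

namespace Matrix

/-- This is the block of one nontrivial first label, a star over the second labels. -/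
theorem charpoly_labelMatrix_block {L : Type*} [Fintype L] [DecidableEq L] [Nonempty L] (d e : ℝ) :
    (of fun x y : Option L => if x = y then d * labelWeight e y - 1 else
        if x = none ∨ y = none then d * labelWeight e y else 0 : Matrix (Option L) (Option L) ℝ).charpoly =
      (!![d - 1, d * (Fintype.card L * e); d, d * e - 1] : Matrix (Fin 2) (Fin 2) ℝ).charpoly *
        (X - C (d * e - 1)) ^ (Fintype.card L - 1) := by
  have h := charpoly_fromBlocks_star (κ₀ := Unit) (κ₁ := Unit) (L := L) (R := ℝ)
    (of fun _ _ => d - 1) (of fun _ _ => d * e)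
    (of fun _ _ => d) (of fun _ _ => d * e - 1)
  have h1 : (of fun _ _ => d * e - 1 : Matrix Unit Unit ℝ).charpoly = X - C (d * e - 1) := by
    rw [charpoly, det_unique, charmatrix_apply_eq]
    rfl
  rw [h1, ← charpoly_reindex Equiv.unitSumUnit (fromBlocks _ _ _ _)] at h
  convert h using 1
  · rw [← charpoly_reindex (Equiv.optionUnitSum L)]
    congr 1
    ext (_ | ⟨_, i⟩) (_ | ⟨_, j⟩) <;>
      simp [Equiv.optionUnitSum, blockDiagonal_apply]
  · congr 2
    ext i j
    fin_cases i <;> fin_cases j <;> simp [Equiv.unitSumUnit]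
    ring

theorem charpoly_labelMatrix {L₁ L₂ : Type*} [Fintype L₁] [DecidableEq L₁] [Nonempty L₁]
    [Fintype L₂] [DecidableEq L₂] [Nonempty L₂] (d e a b : ℝ)
    (ha : a = Fintype.card L₁ * d) (hb : b = Fintype.card L₂ * e) :
    (labelMatrix L₁ L₂ * diagonal (fun x : Option L₁ × Option L₂ => labelWeight d x.1 * labelWeight e x.2) - 1).charpoly =
      (!![0, a, a * b, b; 1, d - 1, d * b, 0; 1, d, d * e - 1, e; 1, 0, a * e, e - 1] :
          Matrix (Fin 4) (Fin 4) ℝ).charpoly *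
        (X - C (d * e - 1)) ^ ((Fintype.card L₁ - 1) * (Fintype.card L₂ - 1)) *
        (!![d - 1, d * b; d, d * e - 1] : Matrix (Fin 2) (Fin 2) ℝ).charpoly ^
          (Fintype.card L₁ - 1) *
        (!![d * e - 1, e; a * e, e - 1] : Matrix (Fin 2) (Fin 2) ℝ).charpoly ^
          (Fintype.card L₂ - 1) := by
  -- Blocks by first label: `A₀` is the centre, `D` one copy, `B₀` and `C₀` the links between them.
  let D : Matrix (Option L₂) (Option L₂) ℝ := of fun x y => if x = y then d * labelWeight e y - 1 else
      if x = none ∨ y = none then d * labelWeight e y else 0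
  let A₀ : Matrix (Option L₂) (Option L₂) ℝ := of fun x y => if x = y then labelWeight e y - 1 else
      if x = none ∨ y = none then labelWeight e y else 0
  let B₀ : Matrix (Option L₂) (Option L₂) ℝ := of fun x y => if x = none ∨ x = y then
        d * labelWeight e y else 0
  let C₀ : Matrix (Option L₂) (Option L₂) ℝ := of fun x y => if y = none ∨ y = x then
        labelWeight e y else 0
  have h1 : reindex (Equiv.prodOptionSum (Option L₂) L₁) (Equiv.prodOptionSum (Option L₂) L₁)
      (labelMatrix L₁ L₂ * diagonal (fun x : Option L₁ × Option L₂ => labelWeight d x.1 * labelWeight e x.2) - 1) =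
      fromBlocks A₀ (of fun i (j : Option L₂ × L₁) => B₀ i j.1)
        (of fun (i : Option L₂ × L₁) j => C₀ i.1 j) (blockDiagonal fun _ : L₁ => D) := by
    ext (x | ⟨x, i⟩) (y | ⟨y, j⟩)
    · rcases x with _ | x <;> rcases y with _ | y <;>
        simp [Equiv.prodOptionSum, A₀, labelMatrix, one_apply]
      all_goals grind
    · rcases x with _ | x <;> rcases y with _ | y <;>
        simp [Equiv.prodOptionSum, B₀, labelMatrix]
    · rcases x with _ | x <;> rcases y with _ | y <;>
        simp [Equiv.prodOptionSum, C₀, labelMatrix]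
    · rcases x with _ | x <;> rcases y with _ | y <;>
        simp [Equiv.prodOptionSum, D, labelMatrix, one_apply, blockDiagonal_apply] <;> grind
  -- Now blocks by second label; `Unit ⊕ Unit` records whether the first label is trivial.
  let A₁ : Matrix (Unit ⊕ Unit) (Unit ⊕ Unit) ℝ :=
    fromBlocks (of fun _ _ => 0) (of fun _ _ => a) (of fun _ _ => 1) (of fun _ _ => d - 1)
  let B₁ : Matrix (Unit ⊕ Unit) (Unit ⊕ Unit) ℝ :=
    fromBlocks (of fun _ _ => e) (of fun _ _ => a * e) 0 (of fun _ _ => d * e)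
  let C₁ : Matrix (Unit ⊕ Unit) (Unit ⊕ Unit) ℝ :=
    fromBlocks (of fun _ _ => 1) 0 (of fun _ _ => 1) (of fun _ _ => d)
  let D₁ : Matrix (Unit ⊕ Unit) (Unit ⊕ Unit) ℝ :=
    fromBlocks (of fun _ _ => e - 1) (of fun _ _ => a * e) (of fun _ _ => e)
      (of fun _ _ => d * e - 1)
  have h2 : reindex (Equiv.optionSumOption L₂) (Equiv.optionSumOption L₂)
      (fromBlocks A₀ ((Fintype.card L₁ : ℝ) • B₀) C₀ D) =
      fromBlocks A₁ (of fun i (j : (Unit ⊕ Unit) × L₂) => B₁ i j.1)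
        (of fun (i : (Unit ⊕ Unit) × L₂) j => C₁ i.1 j) (blockDiagonal fun _ : L₂ => D₁) := by
    ext ((x | x) | ⟨x | x, i⟩) ((y | y) | ⟨y | y, j⟩) <;>
      simp [Equiv.optionSumOption, A₀, B₀, C₀, D, A₁, B₁, C₁, D₁, ha,
        blockDiagonal_apply, mul_assoc]
    all_goals grind
  have h3 : reindex Equiv.unitSumUnitSum Equiv.unitSumUnitSum
      (fromBlocks A₁ ((Fintype.card L₂ : ℝ) • B₁) C₁ D₁) =
      !![0, a, a * b, b; 1, d - 1, d * b, 0; 1, d, d * e - 1, e; 1, 0, a * e, e - 1] := by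
    ext i j
    fin_cases i <;> fin_cases j <;> simp [Equiv.unitSumUnitSum, A₁, B₁, C₁, D₁, hb] <;> ring
  have h4 : D₁.charpoly = (!![d * e - 1, e; a * e, e - 1] : Matrix (Fin 2) (Fin 2) ℝ).charpoly := by
    -- The swap is needed because `D₁` lists `V₄` before `V₃`.
    rw [← charpoly_reindex (Equiv.unitSumUnit.trans (Equiv.swap 0 1))]
    congr 1
    ext i j
    fin_cases i <;> fin_cases j <;> simp [Equiv.unitSumUnit, D₁]
  rw [← charpoly_reindex (Equiv.prodOptionSum (Option L₂) L₁), h1, charpoly_fromBlocks_star,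
    ← charpoly_reindex (Equiv.optionSumOption L₂), h2, charpoly_fromBlocks_star,
    ← charpoly_reindex Equiv.unitSumUnitSum, h3, h4, charpoly_labelMatrix_block, ← hb, mul_pow,
    ← pow_mul, mul_comm (Fintype.card L₁ - 1)]
  ring

end Matrix

/-! ### Fibre sizes and row sums over the four cells -/

theorem IsCyclicLabelling.card_filter {G L : Type*} [Group G] [Fintype G] [DecidableEq L]
    {c : G → Option L} {d : ℕ} (h : IsCyclicLabelling c d) (x : Option L) :
    ((Finset.univ.filter fun a => c a = x).card : ℝ) = labelWeight d x := by
  rcases x with _ | l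
  · have : (Finset.univ.filter fun a => c a = none).card = 1 :=
      Finset.card_eq_one.2 ⟨1, by ext; simp [h.eq_none_iff]⟩
    simp [this]
  · simp [h.card_filter_some]

section

variable {G H L₁ L₂ : Type*} [Group G] [Group H] [Fintype G] [Fintype H] [DecidableEq L₁]
  [DecidableEq L₂] {c₁ : G → Option L₁} {c₂ : H → Option L₂} {d e : ℕ}

theorem IsCyclicLabelling.card_filter_prod (h₁ : IsCyclicLabelling c₁ d)
    (h₂ : IsCyclicLabelling c₂ e) (z : Option L₁ × Option L₂) :
    ((Finset.univ.filter fun w : G × H => (c₁ w.1, c₂ w.2) = z).card : ℝ) =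
      labelWeight d z.1 * labelWeight e z.2 := by
  rw [← h₁.card_filter, ← h₂.card_filter, ← Nat.cast_mul, ← Finset.card_product]
  congr 2
  ext w
  simp [Prod.ext_iff]

theorem IsCyclicLabelling.sum_prod [Fintype L₁] [Fintype L₂] (h₁ : IsCyclicLabelling c₁ d)
    (h₂ : IsCyclicLabelling c₂ e) (F : Option L₁ × Option L₂ → ℝ) :
    ∑ w : G × H, F (c₁ w.1, c₂ w.2) = ∑ z, labelWeight d z.1 * labelWeight e z.2 * F z := by
  rw [← Finset.sum_fiberwise Finset.univ fun w : G × H => (c₁ w.1, c₂ w.2)]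
  refine Finset.sum_congr rfl fun z _ => ?_
  rw [← h₁.card_filter_prod h₂, ← nsmul_eq_mul, ← Finset.sum_const]
  refine Finset.sum_congr rfl fun w hw => ?_
  rw [(Finset.mem_filter.1 hw).2]

theorem IsCyclicLabelling.surjective (h : IsCyclicLabelling c₁ d) (hd : d ≠ 0) :
    Function.Surjective c₁ := by
  intro x
  have h0 : labelWeight (d : ℝ) x ≠ 0 := by
    rcases x with _ | l <;> simp [hd]
  rw [← h.card_filter, Nat.cast_ne_zero, Finset.card_ne_zero] at h0
  obtain ⟨a, ha⟩ := h0
  exact ⟨a, (Finset.mem_filter.1 ha).2⟩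

/-- The index of the cell that contains the elements with a given label. -/
def labelCell {L₁ L₂ : Type*} : Option L₁ × Option L₂ → Fin 4
  | (none, none) => 0
  | (some _, none) => 1
  | (some _, some _) => 2
  | (none, some _) => 3

theorem IsCyclicLabelling.mem_fourCells_iff [DecidableEq G] [DecidableEq H]
    (h₁ : IsCyclicLabelling c₁ d) (h₂ : IsCyclicLabelling c₂ e) (w : G × H) (j : Fin 4) :
    w ∈ fourCells G H j ↔ labelCell (c₁ w.1, c₂ w.2) = j := by
  have e₁ := h₁.eq_none_iff w.1
  have e₂ := h₂.eq_none_iff w.2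
  fin_cases j <;> rcases h₁' : c₁ w.1 with _ | x <;> rcases h₂' : c₂ w.2 with _ | y <;>
    simp_all [fourCells, labelCell]

/-- Row sums of `A` computed on labels; the subtracted indicator removes the diagonal entry, which
`labelMatrix` counts as `1`. -/
theorem sum_labelMatrix_labelCell {L₁ L₂ : Type*} [Fintype L₁] [Fintype L₂] [DecidableEq L₁]
    [DecidableEq L₂] (d e a b : ℝ) (ha : a = Fintype.card L₁ * d) (hb : b = Fintype.card L₂ * e)
    (z : Option L₁ × Option L₂) (j : Fin 4) :
    (∑ w, labelWeight d w.1 * labelWeight e w.2 *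
        if labelCell w = j then labelMatrix L₁ L₂ z w else 0) -
      (if labelCell z = j then 1 else 0) =
      (!![0, a, a * b, b; 1, d - 1, d * b, 0; 1, d, d * e - 1, e; 1, 0, a * e, e - 1] :
        Matrix (Fin 4) (Fin 4) ℝ) (labelCell z) j := by
  subst ha hb
  have h₁ (x y : L₁) : x = y ∨ y = x ↔ x = y := or_iff_left_of_imp Eq.symm
  have h₁' (x y : L₂) : x = y ∨ y = x ↔ x = y := or_iff_left_of_imp Eq.symm
  have h₂ (x x' : L₁) (y y' : L₂) : x = x' ∧ y = y' ∨ x' = x ∧ y' = y ↔ x = x' ∧ y = y' :=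
    or_iff_left_of_imp fun h => ⟨h.1.symm, h.2.symm⟩
  rcases z with ⟨_ | x, _ | y⟩ <;> fin_cases j <;>
    simp [Fintype.sum_prod_type, Fintype.sum_option, labelCell, labelMatrix, h₁, h₁', h₂, ite_and]
  all_goals grind

end

theorem mainTheorem9 (p q n m : ℕ) (hp : p.Prime) (hq : q.Prime) (hpq : p ≠ q)
    (hn : 1 ≤ n) (hm : 1 ≤ m)
    (P Q : Type*) [CommGroup P] [CommGroup Q] [Fintype P] [Fintype Q]
    [DecidableEq P] [DecidableEq Q] [DecidableRel (powerGraph (P × Q)).Adj]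
    (hP : IsElementaryAbelianOfOrder P p n) (hQ : IsElementaryAbelianOfOrder Q q m)
    (α β : ℕ) (hα : α = (p ^ n - 1) / (p - 1)) (hβ : β = (q ^ m - 1) / (q - 1))
    (A : Matrix (P × Q) (P × Q) ℝ) (hA : A = (powerGraph (P × Q)).adjMatrix ℝ)
    (T₁ : Matrix (Fin 4) (Fin 4) ℝ) (hT₁ : T₁ = quotientMatrix A (fourCells P Q))
    (f g : ℝ[X])
    (hf : f = (!![(p : ℝ) - 2, ((p : ℝ) - 1) * ((q : ℝ) ^ m - 1);
                  (p : ℝ) - 1, ((p : ℝ) - 1) * ((q : ℝ) - 1) - 1] :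
                Matrix (Fin 2) (Fin 2) ℝ).charpoly)
    (hg : g = (!![((p : ℝ) - 1) * ((q : ℝ) - 1) - 1, (q : ℝ) - 1;
                  ((p : ℝ) ^ n - 1) * ((q : ℝ) - 1), (q : ℝ) - 2] :
                Matrix (Fin 2) (Fin 2) ℝ).charpoly) :
    IsEquitablePartition A (fourCells P Q) ∧
    T₁ = !![0, (p : ℝ) ^ n - 1, ((p : ℝ) ^ n - 1) * ((q : ℝ) ^ m - 1), (q : ℝ) ^ m - 1;
            1, (p : ℝ) - 2, ((p : ℝ) - 1) * ((q : ℝ) ^ m - 1), 0;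
            1, (p : ℝ) - 1, ((p : ℝ) - 1) * ((q : ℝ) - 1) - 1, (q : ℝ) - 1;
            1, 0, ((p : ℝ) ^ n - 1) * ((q : ℝ) - 1), (q : ℝ) - 2] ∧
    A.charpoly =
      T₁.charpoly * (X + 1) ^ (p ^ n * q ^ m - (α + 1) * (β + 1)) *
        (X - (p : ℝ[X]) * (q : ℝ[X]) + (p : ℝ[X]) + (q : ℝ[X])) ^ ((α - 1) * (β - 1)) *
        f ^ (α - 1) * g ^ (β - 1) := by
  obtain ⟨α', hα', c₁, h₁⟩ := hP.exists_isCyclicLabelling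
  obtain ⟨β', hβ', c₂, h₂⟩ := hQ.exists_isCyclicLabelling
  have hp1 : 0 < p - 1 := Nat.sub_pos_of_lt hp.one_lt
  have hq1 : 0 < q - 1 := Nat.sub_pos_of_lt hq.one_lt
  obtain rfl : α' = α := by rw [hα, hα', Nat.mul_div_cancel _ hp1]
  obtain rfl : β' = β := by rw [hβ, hβ', Nat.mul_div_cancel _ hq1]
  -- As `n ≥ 1`, there is a nontrivial label, so a star has at least one copy and `α - 1` is not
  -- truncated.
  have : Nonempty (Fin α') := Fin.pos_iff_nonempty.1 <| Nat.pos_of_ne_zero fun h => by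
    have := Nat.one_lt_pow (by omega : n ≠ 0) hp.one_lt
    rw [h, zero_mul] at hα'
    omega
  have : Nonempty (Fin β') := Fin.pos_iff_nonempty.1 <| Nat.pos_of_ne_zero fun h => by
    have := Nat.one_lt_pow (by omega : m ≠ 0) hq.one_lt
    rw [h, zero_mul] at hβ'
    omega
  have hd : ((p - 1 : ℕ) : ℝ) = p - 1 := Nat.cast_pred hp.pos
  have he : ((q - 1 : ℕ) : ℝ) = q - 1 := Nat.cast_pred hq.pos
  have ha : (p : ℝ) ^ n - 1 = Fintype.card (Fin α') * ((p - 1 : ℕ) : ℝ) := by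
    rw [Fintype.card_fin, ← Nat.cast_mul, ← hα', Nat.cast_pred (pow_pos hp.pos n), Nat.cast_pow]
  have hb : (q : ℝ) ^ m - 1 = Fintype.card (Fin β') * ((q - 1 : ℕ) : ℝ) := by
    rw [Fintype.card_fin, ← Nat.cast_mul, ← hβ', Nat.cast_pred (pow_pos hq.pos m), Nat.cast_pow]
  set c : P × Q → Option (Fin α') × Option (Fin β') := fun w => (c₁ w.1, c₂ w.2) with hc
  have hAM : A = (Matrix.of fun u v => labelMatrix (Fin α') (Fin β') (c u) (c v)) - 1 := by
    ext u v
    have huv := hP.powerGraph_prod_adj_iff hQ ((Nat.coprime_primes hp hq).2 hpq) h₁ h₂ u v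
    rw [hA, SimpleGraph.adjMatrix_apply]
    simp only [huv]
    by_cases h : u = v
    · simp [h, labelMatrix]
    · simp [h, labelMatrix, c]
  set T : Matrix (Fin 4) (Fin 4) ℝ :=
    !![0, (p : ℝ) ^ n - 1, ((p : ℝ) ^ n - 1) * ((q : ℝ) ^ m - 1), (q : ℝ) ^ m - 1;
       1, (p : ℝ) - 2, ((p : ℝ) - 1) * ((q : ℝ) ^ m - 1), 0;
       1, (p : ℝ) - 1, ((p : ℝ) - 1) * ((q : ℝ) - 1) - 1, (q : ℝ) - 1;
       1, 0, ((p : ℝ) ^ n - 1) * ((q : ℝ) - 1), (q : ℝ) - 2] with hT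
  have hp2 : (p : ℝ) - 2 = p - 1 - 1 := by ring
  have hq2 : (q : ℝ) - 2 = q - 1 - 1 := by ring
  have hcell (u : P × Q) (j : Fin 4) : u ∈ fourCells P Q j ↔ labelCell (c u) = j :=
    h₁.mem_fourCells_iff h₂ u j
  -- Constant row sums give both equitability and, as averages, the quotient matrix.
  have hrow (i j : Fin 4) (u : P × Q) (hu : u ∈ fourCells P Q i) :
      ∑ w ∈ fourCells P Q j, A u w = T i j := by
    have h := sum_labelMatrix_labelCell _ _ _ _ ha hb (c u) j
    rw [← h₁.sum_prod h₂, (hcell u i).1 hu, hd, he, ← hp2, ← hq2] at h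
    rw [hT, ← h, ← (hcell u i).1 hu]
    have hf : fourCells P Q j = Finset.univ.filter fun w => labelCell (c w) = j := by
      ext w
      simp [hcell]
    simp only [hAM, Matrix.sub_apply, Matrix.of_apply, Finset.sum_sub_distrib, hf,
      Finset.sum_filter, Matrix.one_apply, ← ite_and]
    congr 1
    simp only [and_comm (b := u = _), ite_and, Finset.sum_ite_eq, Finset.mem_univ, if_true]
  have hsurj : Function.Surjective c :=
    (h₁.surjective hp1.ne').prodMap (h₂.surjective hq1.ne')
  have hne (i : Fin 4) : (fourCells P Q i).Nonempty := by
    obtain ⟨z, hz⟩ : ∃ z : Option (Fin α') × Option (Fin β'), labelCell z = i := by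
      have x : Fin α' := Classical.arbitrary _
      have y : Fin β' := Classical.arbitrary _
      fin_cases i
      exacts [⟨(none, none), rfl⟩, ⟨(some x, none), rfl⟩, ⟨(some x, some y), rfl⟩,
        ⟨(none, some y), rfl⟩]
    obtain ⟨u, rfl⟩ := hsurj z
    exact ⟨u, (hcell u i).2 hz⟩
  have hTT : T₁ = T := by
    ext i j
    rw [hT₁, quotientMatrix, Matrix.of_apply, Finset.sum_congr rfl fun u hu => hrow i j u hu,
      Finset.sum_const, nsmul_eq_mul]
    exact mul_div_cancel_left₀ _ (Nat.cast_ne_zero.2 (hne i).card_ne_zero)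
  refine ⟨⟨hne, fun v => ⟨labelCell (c v), (hcell v _).2 rfl, fun i hi => ((hcell v i).1 hi).symm⟩,
    fun i j u hu v hv => (hrow i j u hu).trans (hrow i j v hv).symm⟩, hTT, ?_⟩
  have hw : (Matrix.diagonal fun z => ((Finset.univ.filter fun w => c w = z).card : ℝ)) =
      Matrix.diagonal fun z : Option (Fin α') × Option (Fin β') =>
        labelWeight ((p - 1 : ℕ) : ℝ) z.1 * labelWeight ((q - 1 : ℕ) : ℝ) z.2 :=
    congrArg _ (funext fun z => h₁.card_filter_prod h₂ z)
  have hX : (X : ℝ[X]) - C (((p : ℝ) - 1) * ((q : ℝ) - 1) - 1) =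
      X - (p : ℝ[X]) * (q : ℝ[X]) + (p : ℝ[X]) + (q : ℝ[X]) := by
    simp only [map_sub, map_mul, map_natCast, map_one]
    ring
  rw [hAM, Matrix.charpoly_of_comp_sub_one c hsurj, hw,
    Matrix.charpoly_labelMatrix _ _ _ _ ha hb, hTT, hf, hg, hT, hd, he, hX, ← hp2, ← hq2]
  have hcP : Fintype.card P = p ^ n := by rw [← Nat.card_eq_fintype_card, hP.1]
  have hcQ : Fintype.card Q = q ^ m := by rw [← Nat.card_eq_fintype_card, hQ.1]
  simp only [Fintype.card_prod, Fintype.card_option, Fintype.card_fin, hcP, hcQ]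
  ring
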